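/- Let $d\ge 1$, let $\sigma>0$ be known, and write $p(z\mid\mu)=(2\pi\sigma^2)^{-d/2}\exp(-\|z-\mu\|^2/(2\sigma^2))$ for the density of $\mathrm N_d(\mu,\sigma^2I_d)$, where $\mu\in\mathbb R^d$ is unknown. Having observed $x\sim p(\cdot\mid\mu)$, one predicts an independent $y\sim p(\cdot\mid\mu)$ by a predictive density $\hat p(y\mid x)$, i.e. a jointly measurable function $\hat p\ge 0$ with $\int\hat p(y\mid x)\,dy=1$ for every $x$. The loss is the squared $L^2$ Wasserstein distance $$L(\mu,q)=W_2\big(p(\cdot\mid\mu),q\big)^2=\inf_{\gamma}\int\|u-v\|^2\,d\gamma(u,v),$$ the infimum being over all joint laws $\gamma$ with marginals $p(\cdot\mid\mu)$ and $q$, and the risk is $R(\mu,\hat p)=\int L(\mu,\hat p(\cdot\mid x))\,p(x\mid\mu)\,dx$ (values in $[0,\infty]$). A predictive density $\hat p_*$ is minimax if $\sup_\mu R(\mu,\hat p_*)\le\sup_\mu R(\mu,\hat p)$ for every predictive density $\hat p$. Let $\pi:\mathbb R^d\to[0,\infty]$ be a (possibly improper) prior density which is not identically $0$ and is superharmonic: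 it is lower semicontinuous, not identically $\infty$, and for every $x$ and every $r>0$ its mean over the ball $B(x,r)$ is at most $\pi(x)$. Then: 1. for every $x$ the posterior distribution $\pi(\mu\mid x)\propto p(x\mid\mu)\,\pi(\mu)$ is a well-defined probability distribution with a finite mean $\hat\mu^\pi(x)=\int\mu\,\pi(\mu\mid x)\,d\mu$; 2. a (generalized) Bayesian predictive density with respect to $\pi$ exists, namely the plug-in density $\hat p_\pi(y\mid x)=p(y\mid\hat\mu^\pi(x))$; here a predictive density $\hat p$ is called (generalized) Bayesian with respect to $\pi$ if, for almost every $x$, $\hat p(\cdot\mid x)$ minimizes the posterior expected loss $\int L(\mu,q)\,\pi(\mu\mid x)\,d\mu$ among all probability densities $q$ on $\mathbb R^d$; 3. every (generalized) Bayesian predictive density with respect to $\pi$ is minimax. -/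

import Mathlib

open MeasureTheory
open scoped ENNReal

namespace PredictiveDensity

/-- The `d`-dimensional Euclidean space. -/
abbrev E (d : ℕ) : Type := EuclideanSpace ℝ (Fin d)

/-- The `L²` Wasserstein distance of two measures on `ℝ^d`: the square root of the infimum of
`∫ ‖u - v‖² dγ(u, v)` over all joint laws `γ` with marginals `P` and `Q`. The value is `∞` when
no joint law has a finite cost. -/
noncomputable def wassersteinTwo {d : ℕ} (P Q : Measure (E d)) : ℝ≥0∞ :=
  (⨅ γ ∈ {γ : Measure (E d × E d) | γ.map Prod.fst = P ∧ γ.map Prod.snd = Q},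
    ∫⁻ z, edist z.1 z.2 ^ 2 ∂γ) ^ (1 / 2 : ℝ)

/-- The density at `z` of the normal distribution `N_d(μ, σ² I_d)`. -/
noncomputable def normalDensity {d : ℕ} (σ : ℝ) (μ z : E d) : ℝ≥0∞ :=
  ENNReal.ofReal
    ((2 * Real.pi * σ ^ 2) ^ (-(d : ℝ) / 2) * Real.exp (-‖z - μ‖ ^ 2 / (2 * σ ^ 2)))

/-- The distribution on `ℝ^d` with Lebesgue density `q`. -/
noncomputable def law {d : ℕ} (q : E d → ℝ≥0∞) : Measure (E d) :=
  volume.withDensity q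

/-- `q` is a probability density on `ℝ^d`. -/
structure IsDensity {d : ℕ} (q : E d → ℝ≥0∞) : Prop where
  measurable : Measurable q
  lintegral_eq_one : ∫⁻ y, q y = 1

/-- `p x y` is a predictive density: the density at `y` which is announced after `x` has
been observed. -/
structure IsPredictiveDensity {d : ℕ} (p : E d → E d → ℝ≥0∞) : Prop where
  measurable : Measurable (Function.uncurry p)
  lintegral_eq_one : ∀ x, ∫⁻ y, p x y = 1

/-- The `L²` Wasserstein loss of the announced density `q` when the future observation has the
distribution `N_d(μ, σ² I_d)`. -/
noncomputable def loss {d : ℕ} (σ : ℝ) (μ : E d) (q : E d → ℝ≥0∞) : ℝ≥0∞ :=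
  wassersteinTwo (law (normalDensity σ μ)) (law q) ^ 2

/-- The risk at `μ` of a predictive density, for `x ∼ N_d(μ, σ² I_d)`. -/
noncomputable def risk {d : ℕ} (σ : ℝ) (μ : E d) (p : E d → E d → ℝ≥0∞) : ℝ≥0∞ :=
  ∫⁻ x, loss σ μ (p x) * normalDensity σ μ x

/-- `p` minimizes the maximum risk among all predictive densities. -/
def IsMinimax {d : ℕ} (σ : ℝ) (p : E d → E d → ℝ≥0∞) : Prop :=
  IsPredictiveDensity p ∧
    ∀ q : E d → E d → ℝ≥0∞, IsPredictiveDensity q → (⨆ μ, risk σ μ p) ≤ ⨆ μ, risk σ μ q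

/-- Nonnegative superharmonic functions on `ℝ^d`, with the value `∞` allowed: lower
semicontinuous, not identically `∞`, and at every point at least the mean over each ball centred
there. -/
structure IsSuperharmonic {d : ℕ} (π : E d → ℝ≥0∞) : Prop where
  lowerSemicontinuous : LowerSemicontinuous π
  exists_ne_top : ∃ x, π x ≠ ∞
  laverage_ball_le : ∀ x r, 0 < r → (⨍⁻ y in Metric.ball x r, π y ∂volume) ≤ π x

/-- The posterior distribution of `μ` given `x ∼ N_d(μ, σ² I_d)`, for the prior with (possibly
improper) density `π`: the normalization of `p(x | μ) π(μ) dμ`. -/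
noncomputable def posterior {d : ℕ} (σ : ℝ) (π : E d → ℝ≥0∞) (x : E d) : Measure (E d) :=
  (∫⁻ μ, normalDensity σ μ x * π μ)⁻¹ •
    volume.withDensity (fun μ => normalDensity σ μ x * π μ)

/-- The posterior mean of `μ`. -/
noncomputable def posteriorMean {d : ℕ} (σ : ℝ) (π : E d → ℝ≥0∞) (x : E d) : E d :=
  ∫ μ, μ ∂(posterior σ π x)

/-- The plug-in predictive density of an estimator `m` of `μ`. -/
noncomputable def plugIn {d : ℕ} (σ : ℝ) (m : E d → E d) (x : E d) : E d → ℝ≥0∞ :=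
  normalDensity σ (m x)

/-- `p` is a (generalized) Bayesian predictive density with respect to the prior density `π`: for
almost every observation `x` the density `p x` minimizes the posterior expected loss. (For an
improper prior the integral of the risk against the prior may be infinite for every predictive
density, so the minimization is done observation by observation.) -/
def IsBayes {d : ℕ} (σ : ℝ) (π : E d → ℝ≥0∞) (p : E d → E d → ℝ≥0∞) : Prop :=
  IsPredictiveDensity p ∧
    ∀ᵐ x : E d, ∀ q : E d → ℝ≥0∞, IsDensity q →
      ∫⁻ μ, loss σ μ (p x) ∂(posterior σ π x) ≤ ∫⁻ μ, loss σ μ q ∂(posterior σ π x)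

end PredictiveDensity

namespace PredictiveDensity

/-! The problem reduces to estimating `μ` under squared error. Translating one marginal of a
coupling changes its quadratic cost by an amount that depends only on the means. Hence the loss of
`q` is `‖μ - m‖²`, with `m` the mean of `q`, plus a term independent of `μ` (`loss_eq_add`); that
term vanishes for a normal density of variance `σ²`. So the plug-in at the posterior mean is Bayes,
and every Bayes density has, for almost every `x`, the loss `‖μ - posteriorMean σ π x‖²`
(`loss_eq_of_lintegral_loss_le`).

The minimax value is `d σ²`. It bounds every maximum risk from below, as the limit of the Bayes
risks for the priors `N(0, τ² I)` as `τ → ∞` (`ofReal_le_iSup_risk`).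

For the upper bound, superharmonicity makes the normal means of `π` decrease as the variance grows
(`IsSuperharmonic.marginal_sqrt_le`). Its infinitesimal form says that the posterior second moment
about `x`, which is `∑ (Var_i + b_i²)` with `b` the posterior mean minus `x`, is at most `d σ²`
(`integral_norm_sub_sq_posterior_le`). The derivative of the posterior mean is the posterior
variance over `σ²`, so Stein's identity writes the risk as the expectation of `∑ (2 Var_i + b_i²)`
minus `d σ²`. The sum is at most `2 d σ²`, so the risk is at most `d σ²`. -/

variable {d : ℕ} {σ τ : ℝ} {π : E d → ℝ≥0∞}

/-! ### Normal densities -/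

theorem measurable_uncurry_normalDensity :
    Measurable (Function.uncurry (normalDensity (d := d) σ)) := by
  apply Measurable.ennreal_ofReal
  apply Continuous.measurable
  fun_prop

theorem measurable_normalDensity_left (x : E d) : Measurable fun μ => normalDensity σ μ x :=
  Measurable.of_uncurry_right (y := x) measurable_uncurry_normalDensity

theorem measurable_normalDensity (μ : E d) : Measurable (normalDensity σ μ) :=
  Measurable.of_uncurry_left (x := μ) measurable_uncurry_normalDensity

theorem normalDensity_comm (μ z : E d) : normalDensity σ μ z = normalDensity σ z μ := by
  simp only [normalDensity, norm_sub_rev]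

theorem normalDensity_ne_top (μ z : E d) : normalDensity σ μ z ≠ ∞ := ENNReal.ofReal_ne_top

theorem normalDensity_ne_zero (hσ : 0 < σ) (μ z : E d) : normalDensity σ μ z ≠ 0 := by
  simp only [normalDensity, ne_eq, ENNReal.ofReal_eq_zero, not_le]
  positivity

theorem lintegral_normalDensity (hσ : 0 < σ) (μ : E d) : ∫⁻ z, normalDensity σ μ z = 1 := by
  have h0 : ∀ z : E d, -‖z‖ ^ 2 / (2 * σ ^ 2) = -(1 / (2 * σ ^ 2)) * ‖z‖ ^ 2 := fun z => by ring
  have hb : 0 < 1 / (2 * σ ^ 2) := by positivity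
  have h1 := GaussianFourier.integral_rexp_neg_mul_sq_norm (V := E d) hb
  have hint : Integrable fun z : E d => Real.exp (-(1 / (2 * σ ^ 2)) * ‖z‖ ^ 2) := by
    refine Integrable.of_integral_ne_zero ?_
    rw [h1]
    positivity
  unfold normalDensity
  rw [lintegral_sub_right_eq_self (μ := volume) (fun z : E d => ENNReal.ofReal
    ((2 * Real.pi * σ ^ 2) ^ (-(d : ℝ) / 2) * Real.exp (-‖z‖ ^ 2 / (2 * σ ^ 2)))) μ]
  simp_rw [h0]
  rw [← ofReal_integral_eq_lintegral_ofReal (hint.const_mul _)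
    (Filter.Eventually.of_forall fun z => by positivity), integral_const_mul, h1]
  rw [finrank_euclideanSpace_fin, show Real.pi / (1 / (2 * σ ^ 2)) = 2 * Real.pi * σ ^ 2 by
    field_simp, ← Real.rpow_add (by positivity)]
  simp [neg_div]

/-- Completing the square in the product of two normal densities. -/
theorem normalDensity_mul_normalDensity {s ρ : ℝ} (hσ : 0 < σ) (hτ : 0 < τ) (hs : 0 < s)
    (hρ : 0 < ρ) (h1 : s ^ 2 = σ ^ 2 + τ ^ 2) (h2 : ρ * s = σ * τ) (x c μ : E d) :
    normalDensity σ μ x * normalDensity τ c μ =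
      normalDensity s c x * normalDensity ρ (c + (τ ^ 2 / s ^ 2) • (x - c)) μ := by
  unfold normalDensity
  rw [← ENNReal.ofReal_mul (by positivity), ← ENNReal.ofReal_mul (by positivity)]
  congr 1
  have hc : (2 * Real.pi * σ ^ 2) ^ (-(d : ℝ) / 2) * (2 * Real.pi * τ ^ 2) ^ (-(d : ℝ) / 2) =
      (2 * Real.pi * s ^ 2) ^ (-(d : ℝ) / 2) * (2 * Real.pi * ρ ^ 2) ^ (-(d : ℝ) / 2) := by
    rw [← Real.mul_rpow (by positivity) (by positivity),
      ← Real.mul_rpow (by positivity) (by positivity)]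
    congr 1
    linear_combination (-4 * Real.pi ^ 2) * (ρ * s + σ * τ) * h2
  have he : -‖x - μ‖ ^ 2 / (2 * σ ^ 2) + -‖μ - c‖ ^ 2 / (2 * τ ^ 2) =
      -‖x - c‖ ^ 2 / (2 * s ^ 2) +
        -‖μ - (c + (τ ^ 2 / s ^ 2) • (x - c))‖ ^ 2 / (2 * ρ ^ 2) := by
    have e1 : x - μ = (x - c) - (μ - c) := by abel
    have e2 : μ - (c + (τ ^ 2 / s ^ 2) • (x - c)) = (μ - c) - (τ ^ 2 / s ^ 2) • (x - c) := by abel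
    rw [e1, e2]
    generalize x - c = u
    generalize μ - c = v
    rw [norm_sub_sq_real, norm_sub_sq_real, norm_smul, inner_smul_right,
      real_inner_comm u v, mul_pow, Real.norm_eq_abs, sq_abs]
    generalize inner ℝ u v = p
    generalize ‖u‖ = a
    generalize ‖v‖ = b
    have hρ2 : ρ ^ 2 = σ ^ 2 * τ ^ 2 / s ^ 2 := by
      rw [eq_div_iff (by positivity)]
      linear_combination (ρ * s + σ * τ) * h2
    rw [hρ2, h1]
    field_simp
    ring
  rw [mul_mul_mul_comm, ← Real.exp_add, hc, he, Real.exp_add, mul_mul_mul_comm]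

/-! ### Superharmonic priors and the marginal density of the observation -/

theorem IsSuperharmonic.measurable (hπ : IsSuperharmonic π) : Measurable π :=
  hπ.lowerSemicontinuous.measurable

/-- A ball mean inequality implies the inequality for normal means. -/
theorem IsSuperharmonic.lintegral_normalDensity_mul_le (hπ : IsSuperharmonic π) (hσ : 0 < σ)
    (x : E d) : ∫⁻ μ, normalDensity σ μ x * π μ ≤ π x := by
  -- Layer-cake argument: the superlevel sets of the normal kernel are balls centred at `x`, where
  -- the mean inequality applies.
  have key : ∀ t ∈ Set.Ioi (0 : ℝ), (volume.withDensity π) {μ | t < (normalDensity σ μ x).toReal} ≤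
      (volume.withDensity fun _ => π x) {μ | t < (normalDensity σ μ x).toReal} := by
    intro t ht
    have hball : {μ | t < (normalDensity σ μ x).toReal} = Metric.ball x
        √(2 * σ ^ 2 * Real.log ((2 * Real.pi * σ ^ 2) ^ (-(d : ℝ) / 2) / t)) := by
      ext μ
      have hc : 0 < (2 * Real.pi * σ ^ 2) ^ (-(d : ℝ) / 2) := by positivity
      simp only [Set.mem_ofPred_eq, Metric.mem_ball, dist_eq_norm, normalDensity]
      rw [ENNReal.toReal_ofReal (by positivity), Real.lt_sqrt (norm_nonneg _),
        norm_sub_rev μ x, ← div_lt_iff₀' hc, ← Real.log_lt_iff_lt_exp (div_pos ht hc),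
        neg_div _ (‖x - μ‖ ^ 2), lt_neg, ← Real.log_inv, inv_div, div_lt_iff₀ (by positivity),
        mul_comm (2 * σ ^ 2)]
    rw [hball]
    generalize √(2 * σ ^ 2 * Real.log ((2 * Real.pi * σ ^ 2) ^ (-(d : ℝ) / 2) / t)) = r
    -- For levels at or above the maximum of the kernel the logarithm is nonpositive, so the square
    -- root is `0` and the ball is empty.
    rcases le_or_gt r 0 with hr | hr
    · simp [Metric.ball_eq_empty.2 hr]
    · have h := hπ.laverage_ball_le x r hr
      rw [setLAverage_eq, ENNReal.div_le_iff (Metric.measure_ball_pos volume x hr).ne'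
        measure_ball_lt_top.ne] at h
      rw [withDensity_apply _ measurableSet_ball, withDensity_apply _ measurableSet_ball,
        setLIntegral_const]
      exact h
  have hreal : ∀ μ, ENNReal.ofReal (normalDensity σ μ x).toReal = normalDensity σ μ x :=
    fun μ => ENNReal.ofReal_toReal (normalDensity_ne_top _ _)
  have hm : Measurable fun μ => (normalDensity σ μ x).toReal :=
    (measurable_normalDensity_left x).ennreal_toReal
  have h0 : ∀ ν : Measure (E d), ∫⁻ μ, normalDensity σ μ x ∂ν =
      ∫⁻ t in Set.Ioi (0 : ℝ), ν {μ | t < (normalDensity σ μ x).toReal} := fun ν => by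
    rw [← lintegral_eq_lintegral_meas_lt ν (Filter.Eventually.of_forall fun μ =>
      ENNReal.toReal_nonneg) hm.aemeasurable]
    simp_rw [hreal]
  calc ∫⁻ μ, normalDensity σ μ x * π μ
      = ∫⁻ μ, normalDensity σ μ x ∂(volume.withDensity π) := by
        rw [lintegral_withDensity_eq_lintegral_mul _ hπ.measurable
          (measurable_normalDensity_left x)]
        simp_rw [Pi.mul_apply, mul_comm]
    _ ≤ ∫⁻ μ, normalDensity σ μ x ∂(volume.withDensity fun _ => π x) := by
        rw [h0, h0]
        exact setLIntegral_mono' measurableSet_Ioi key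
    _ = π x := by
        rw [lintegral_withDensity_eq_lintegral_mul _ measurable_const
          (measurable_normalDensity_left x)]
        simp_rw [Pi.mul_apply, normalDensity_comm _ x]
        rw [lintegral_const_mul _ (measurable_normalDensity x), lintegral_normalDensity hσ,
          mul_one]

/-- The density of the observation for the prior density `π`. -/
noncomputable def marginal (σ : ℝ) (π : E d → ℝ≥0∞) (x : E d) : ℝ≥0∞ :=
  ∫⁻ μ, normalDensity σ μ x * π μ

/-- Semigroup property: the normal kernel of variance `σ² + τ²` is the convolution of those of
variances `σ²` and `τ²`. Smoothing `π` first with variance `τ²` only decreases it. -/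
theorem IsSuperharmonic.marginal_sqrt_le (hπ : IsSuperharmonic π) (hσ : 0 < σ) (hτ : 0 < τ)
    (x : E d) : marginal √(σ ^ 2 + τ ^ 2) π x ≤ marginal σ π x := by
  set s := √(σ ^ 2 + τ ^ 2) with hs
  have hs0 : 0 < s := by positivity
  have hs2 : s ^ 2 = σ ^ 2 + τ ^ 2 := Real.sq_sqrt (by positivity)
  have hρ0 : 0 < σ * τ / s := by positivity
  have hconv : ∀ μ : E d,
      normalDensity s μ x = ∫⁻ z, normalDensity σ z x * normalDensity τ μ z := fun μ => by
    simp_rw [fun z => normalDensity_mul_normalDensity hσ hτ hs0 hρ0 hs2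
      (div_mul_cancel₀ _ hs0.ne') x μ z]
    rw [lintegral_const_mul _ (measurable_normalDensity _), lintegral_normalDensity hρ0, mul_one]
  calc marginal s π x
      = ∫⁻ μ, ∫⁻ z, normalDensity σ z x * normalDensity τ μ z * π μ := by
        unfold marginal
        refine lintegral_congr fun μ => ?_
        rw [hconv, lintegral_mul_const]
        exact (measurable_normalDensity_left x).mul (measurable_normalDensity μ)
    _ = ∫⁻ z, ∫⁻ μ, normalDensity σ z x * normalDensity τ μ z * π μ := by
        refine lintegral_lintegral_swap (Measurable.aemeasurable ?_)
        exact (((measurable_normalDensity_left x).comp measurable_snd).mul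
          measurable_uncurry_normalDensity).mul (hπ.measurable.comp measurable_fst)
    _ = ∫⁻ z, normalDensity σ z x * ∫⁻ μ, normalDensity τ μ z * π μ := by
        refine lintegral_congr fun z => ?_
        simp_rw [mul_assoc]
        exact lintegral_const_mul _ ((measurable_normalDensity_left z).mul hπ.measurable)
    _ ≤ marginal σ π x :=
        lintegral_mono fun z => by
          gcongr
          exact hπ.lintegral_normalDensity_mul_le hτ z

/-- Since `π x` itself may be infinite, the kernel at `x` is dominated by a multiple of a wider
kernel centred at a point `x₀` where `π` is finite. -/
theorem IsSuperharmonic.marginal_ne_top (hπ : IsSuperharmonic π) (hσ : 0 < σ) (x : E d) :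
    marginal σ π x ≠ ∞ := by
  obtain ⟨x₀, hx₀⟩ := hπ.exists_ne_top
  set c₁ : ℝ := (2 * Real.pi * σ ^ 2) ^ (-(d : ℝ) / 2)
  set c₂ : ℝ := (2 * Real.pi * (2 * σ) ^ 2) ^ (-(d : ℝ) / 2)
  have hc₁ : 0 < c₁ := by positivity
  have hc₂ : 0 < c₂ := by positivity
  set C : ℝ := c₁ / c₂ * Real.exp (‖x - x₀‖ ^ 2 / (4 * σ ^ 2))
  have hle : ∀ μ, normalDensity σ μ x ≤ ENNReal.ofReal C * normalDensity (2 * σ) μ x₀ := fun μ => by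
    unfold normalDensity
    rw [← ENNReal.ofReal_mul (by positivity)]
    apply ENNReal.ofReal_le_ofReal
    change c₁ * _ ≤ C * (c₂ * _)
    have : C * (c₂ * Real.exp (-‖x₀ - μ‖ ^ 2 / (2 * (2 * σ) ^ 2))) = c₁ *
        Real.exp (‖x - x₀‖ ^ 2 / (4 * σ ^ 2) + -‖x₀ - μ‖ ^ 2 / (2 * (2 * σ) ^ 2)) := by
      rw [Real.exp_add]
      simp only [C]
      field_simp
    rw [this]
    gcongr
    have h1 : ‖x₀ - μ‖ ≤ ‖x - μ‖ + ‖x - x₀‖ := by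
      rw [show x₀ - μ = (x - μ) - (x - x₀) by abel]
      exact norm_sub_le _ _
    have h2 : ‖x₀ - μ‖ ^ 2 ≤ (‖x - μ‖ + ‖x - x₀‖) ^ 2 := by gcongr
    have h3 : ‖x - x₀‖ ^ 2 / (4 * σ ^ 2) + -‖x₀ - μ‖ ^ 2 / (2 * (2 * σ) ^ 2) -
        -‖x - μ‖ ^ 2 / (2 * σ ^ 2) = (8 * σ ^ 2)⁻¹ *
          (2 * ‖x - x₀‖ ^ 2 - ‖x₀ - μ‖ ^ 2 + 4 * ‖x - μ‖ ^ 2) := by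
      field_simp
      ring
    rw [← sub_nonneg, h3]
    have h4 := h2.trans add_sq_le
    have h5 := sq_nonneg ‖x - μ‖
    exact mul_nonneg (by positivity) (by linarith)
  refine ne_top_of_le_ne_top (ENNReal.mul_ne_top (ENNReal.ofReal_ne_top (r := C)) hx₀) ?_
  calc marginal σ π x ≤ ∫⁻ μ, ENNReal.ofReal C * (normalDensity (2 * σ) μ x₀ * π μ) :=
        lintegral_mono fun μ => by
          rw [← mul_assoc]
          gcongr
          exact hle μ
    _ ≤ ENNReal.ofReal C * π x₀ := by
        rw [lintegral_const_mul' _ _ ENNReal.ofReal_ne_top]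
        gcongr
        exact hπ.lintegral_normalDensity_mul_le (by positivity) x₀

/-- By lower semicontinuity `π` is positive on a nonempty open set, which has positive volume. -/
theorem IsSuperharmonic.marginal_ne_zero (hπ : IsSuperharmonic π) (h0 : ∃ μ, π μ ≠ 0)
    (hσ : 0 < σ) (x : E d) : marginal σ π x ≠ 0 := by
  obtain ⟨μ₀, hμ₀⟩ := h0
  intro h
  have hm : Measurable fun μ => normalDensity σ μ x * π μ :=
    (measurable_normalDensity_left x).mul hπ.measurable
  rw [marginal, lintegral_eq_zero_iff hm] at h
  have hopen : IsOpen {μ | 0 < π μ} := hπ.lowerSemicontinuous.isOpen_preimage 0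
  refine (hopen.measure_pos volume ⟨μ₀, pos_iff_ne_zero.2 hμ₀⟩).ne' ?_
  refine measure_mono_null (fun μ hμ => ?_) h
  simp only [Set.mem_compl_iff, Set.mem_ofPred_eq, Pi.zero_apply, mul_eq_zero, not_or]
  exact ⟨normalDensity_ne_zero hσ _ _, hμ.ne'⟩

/-! ### The posterior distribution: tilting, moments, derivative of the mean -/

theorem measurable_posterior (hπ : Measurable π) : Measurable (posterior σ π) := by
  refine Measure.measurable_of_measurable_coe _ fun s hs => ?_
  have hm : Measurable (Function.uncurry fun (x μ : E d) => normalDensity σ μ x * π μ) :=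
    (measurable_uncurry_normalDensity.comp measurable_swap).mul (hπ.comp measurable_snd)
  simp only [posterior, Measure.smul_apply, smul_eq_mul, withDensity_apply _ hs]
  exact hm.lintegral_prod_right'.inv.mul hm.lintegral_prod_right'

section Posterior

variable (hπ : IsSuperharmonic π) (h0 : ∃ μ, π μ ≠ 0) (hσ : 0 < σ)
include hπ h0 hσ

theorem isProbabilityMeasure_posterior (x : E d) : IsProbabilityMeasure (posterior σ π x) := by
  constructor
  rw [posterior, Measure.smul_apply, withDensity_apply _ MeasurableSet.univ, setLIntegral_univ]
  exact ENNReal.inv_mul_cancel (hπ.marginal_ne_zero h0 hσ x) (hπ.marginal_ne_top hσ x)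

omit h0 hσ in
theorem lintegral_posterior {f : E d → ℝ≥0∞} (hf : Measurable f) (x : E d) :
    ∫⁻ μ, f μ ∂(posterior σ π x) =
      (marginal σ π x)⁻¹ * ∫⁻ μ, normalDensity σ μ x * π μ * f μ := by
  have hm : Measurable fun μ => normalDensity σ μ x * π μ :=
    (measurable_normalDensity_left x).mul hπ.measurable
  rw [posterior, lintegral_smul_measure, lintegral_withDensity_eq_lintegral_mul _ hm hf]
  rfl

omit hπ h0 hσ in
-- As `P` has mass one, `a` must be the inverse of the normalizing integral. This integral is
-- therefore finite, so integrability need not be assumed.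
theorem tilted_eq_of_eq_smul_withDensity {α : Type*} [MeasurableSpace α] {P Q : Measure α}
    [IsProbabilityMeasure P] [NeZero Q] {f : α → ℝ} (hf : Measurable f) {a : ℝ≥0∞}
    (h : P = a • Q.withDensity fun x => ENNReal.ofReal (Real.exp (f x))) :
    Integrable (fun x => Real.exp (f x)) Q ∧ P = Q.tilted f := by
  have h1 : a * ∫⁻ x, ENNReal.ofReal (Real.exp (f x)) ∂Q = 1 := by
    have := measure_univ (μ := P)
    rwa [h, Measure.smul_apply, withDensity_apply _ MeasurableSet.univ, setLIntegral_univ] at this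
  have hI0 : ∫⁻ x, ENNReal.ofReal (Real.exp (f x)) ∂Q ≠ 0 := right_ne_zero_of_mul_eq_one h1
  have ha : a = (∫⁻ x, ENNReal.ofReal (Real.exp (f x)) ∂Q)⁻¹ :=
    ENNReal.eq_inv_of_mul_eq_one_left h1
  have hItop : ∫⁻ x, ENNReal.ofReal (Real.exp (f x)) ∂Q ≠ ∞ := fun h => by
    rw [ha, h] at h1
    simp at h1
  have hint : Integrable (fun x => Real.exp (f x)) Q :=
    (lintegral_ofReal_ne_top_iff_integrable hf.exp.aestronglyMeasurable
      (Filter.Eventually.of_forall fun x => (Real.exp_pos _).le)).1 hItop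
  refine ⟨hint, ?_⟩
  rw [h, Measure.tilted, ← withDensity_smul _ hf.exp.ennreal_ofReal]
  congr 1
  ext x
  rw [Pi.smul_apply, smul_eq_mul, ENNReal.ofReal_div_of_pos (integral_exp_pos hint),
    ofReal_integral_eq_lintegral_ofReal hint
      (Filter.Eventually.of_forall fun x => (Real.exp_pos _).le), ha, mul_comm]
  rfl

omit hπ h0 in
theorem normalDensity_add (μ x v : E d) :
    normalDensity σ μ (x + v) =
      ENNReal.ofReal (Real.exp (-(2 * inner ℝ x v + ‖v‖ ^ 2) / (2 * σ ^ 2))) *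
        (normalDensity σ μ x * ENNReal.ofReal (Real.exp (inner ℝ v μ / σ ^ 2))) := by
  unfold normalDensity
  rw [← ENNReal.ofReal_mul (by positivity), ← ENNReal.ofReal_mul (by positivity)]
  congr 1
  generalize (2 * Real.pi * σ ^ 2) ^ (-(d : ℝ) / 2) = c
  rw [mul_assoc, mul_left_comm, ← Real.exp_add, ← Real.exp_add]
  congr 2
  rw [add_sub_right_comm, norm_add_sq_real, inner_sub_left, real_inner_comm v μ]
  field_simp
  ring

/-- Shifting the observation tilts the posterior distribution. -/
theorem posterior_add (x v : E d) :
    Integrable (fun μ => Real.exp (inner ℝ v μ / σ ^ 2)) (posterior σ π x) ∧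
      posterior σ π (x + v) = (posterior σ π x).tilted fun μ => inner ℝ v μ / σ ^ 2 := by
  have := isProbabilityMeasure_posterior hπ h0 hσ x
  have := isProbabilityMeasure_posterior hπ h0 hσ (x + v)
  set K := ENNReal.ofReal (Real.exp (-(2 * inner ℝ x v + ‖v‖ ^ 2) / (2 * σ ^ 2)))
  have hm : Measurable fun μ : E d => inner ℝ v μ / σ ^ 2 := by fun_prop
  have hφ : Measurable fun μ => normalDensity σ μ x * π μ :=
    (measurable_normalDensity_left x).mul hπ.measurable
  refine tilted_eq_of_eq_smul_withDensity hm (a := (marginal σ π (x + v))⁻¹ * K *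
    marginal σ π x) ?_
  have hd : (fun μ => normalDensity σ μ (x + v) * π μ) =
      K • ((fun μ => normalDensity σ μ x * π μ) *
        fun μ => ENNReal.ofReal (Real.exp (inner ℝ v μ / σ ^ 2))) := by
    ext μ
    simp only [Pi.smul_apply, Pi.mul_apply, smul_eq_mul]
    rw [normalDensity_add hσ]
    ring
  have hg : Measurable fun μ : E d => ENNReal.ofReal (Real.exp (inner ℝ v μ / σ ^ 2)) :=
    hm.exp.ennreal_ofReal
  rw [posterior, hd, withDensity_smul _ (hφ.mul hg), withDensity_mul _ hφ hg, posterior,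
    withDensity_smul_measure, smul_smul, smul_smul]
  congr 1
  change _ = _ * marginal σ π x * (marginal σ π x)⁻¹
  rw [mul_assoc _ (marginal σ π x), ENNReal.mul_inv_cancel (hπ.marginal_ne_zero h0 hσ x)
    (hπ.marginal_ne_top hσ x), mul_one, ← hd]
  rfl

/-- The posterior at every shifted observation is proper, which makes all exponential moments
finite; polynomial moments and smoothness of the cumulant generating function follow. -/
theorem integrableExpSet_posterior (x : E d) (i : Fin d) :
    ProbabilityTheory.integrableExpSet (fun μ : E d => μ i) (posterior σ π x) = Set.univ := by
  refine Set.eq_univ_of_forall fun t => ?_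
  have h := (posterior_add hπ h0 hσ x (EuclideanSpace.single i (σ ^ 2 * t))).1
  refine h.congr (Filter.Eventually.of_forall fun μ => ?_)
  simp only [EuclideanSpace.inner_single_left, conj_trivial]
  congr 1
  field_simp

theorem memLp_eval_posterior (x : E d) (i : Fin d) :
    MemLp (fun μ : E d => μ i) 2 (posterior σ π x) := by
  refine ProbabilityTheory.memLp_of_mem_interior_integrableExpSet ?_ 2
  simp [integrableExpSet_posterior hπ h0 hσ]

theorem memLp_id_posterior (x : E d) : MemLp (fun μ : E d => μ) 2 (posterior σ π x) :=
  MemLp.of_eval_piLp fun i => memLp_eval_posterior hπ h0 hσ x i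

theorem integrable_id_posterior (x : E d) : Integrable (fun μ : E d => μ) (posterior σ π x) :=
  have := isProbabilityMeasure_posterior hπ h0 hσ x
  (memLp_id_posterior hπ h0 hσ x).integrable (by norm_num)

theorem posteriorMean_apply (x : E d) (i : Fin d) :
    posteriorMean σ π x i = ∫ μ, μ i ∂(posterior σ π x) :=
  eval_integral_piLp (fun i => (integrable_id_posterior hπ h0 hσ x).eval_piLp i) i

/-- The derivative of the posterior mean is the posterior variance. -/
theorem hasLineDerivAt_posteriorMean (x : E d) (i : Fin d) :
    HasLineDerivAt ℝ (fun x => posteriorMean σ π x i)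
      (ProbabilityTheory.variance (fun μ => μ i) (posterior σ π x) / σ ^ 2) x
      (EuclideanSpace.single i 1) := by
  have := isProbabilityMeasure_posterior hπ h0 hσ x
  have hint : ∀ t, t ∈ interior
      (ProbabilityTheory.integrableExpSet (fun μ : E d => μ i) (posterior σ π x)) := by
    simp [integrableExpSet_posterior hπ h0 hσ]
  set g := ProbabilityTheory.cgf (fun μ : E d => μ i) (posterior σ π x)
  -- Moving `x` by `t` along coordinate `i` tilts the posterior by `(t / σ²) μ_i`, and the mean
  -- under a tilt is the derivative of the cumulant generating function.
  have hmean : ∀ t : ℝ, posteriorMean σ π (x + t • EuclideanSpace.single i 1) i =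
      deriv g (t / σ ^ 2) := fun t => by
    rw [posteriorMean_apply hπ h0 hσ, (posterior_add hπ h0 hσ _ _).2,
      ← ProbabilityTheory.integral_tilted_mul_self (hint _)]
    congr 2
    ext μ
    simp [EuclideanSpace.inner_single_left, real_inner_smul_left]
    ring
  have hvar : ProbabilityTheory.variance (fun μ => μ i) (posterior σ π x) =
      deriv (deriv g) 0 := by
    rw [← iteratedDeriv_one (f := g), ← iteratedDeriv_succ, ← ProbabilityTheory.variance_tilted_mul (hint 0)]
    simp
  have hg : HasDerivAt (deriv g) (deriv (deriv g) 0) 0 :=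
    (ProbabilityTheory.analyticAt_cgf (hint 0)).deriv.differentiableAt.hasDerivAt
  unfold HasLineDerivAt
  simp_rw [hmean, hvar]
  have hlin : HasDerivAt (fun t : ℝ => t / σ ^ 2) (1 / σ ^ 2) 0 := (hasDerivAt_id 0).div_const _
  have := HasDerivAt.comp (0 : ℝ) (h₂ := deriv g) (h₂' := deriv (deriv g) 0)
    (by rwa [zero_div]) hlin
  rw [div_eq_mul_one_div]
  exact this

theorem integrable_norm_sub_sq_posterior (x c : E d) :
    Integrable (fun μ => ‖μ - c‖ ^ 2) (posterior σ π x) :=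
  have := isProbabilityMeasure_posterior hπ h0 hσ x
  ((memLp_id_posterior hπ h0 hσ x).sub (memLp_const c)).integrable_norm_pow (by norm_num)

/-- The posterior second moment about the observation is at most its value for the
uniform prior. -/
theorem integral_norm_sub_sq_posterior_le (x : E d) :
    ∫ μ, ‖μ - x‖ ^ 2 ∂(posterior σ π x) ≤ d * σ ^ 2 := by
  have := isProbabilityMeasure_posterior hπ h0 hσ x
  have hint := integrable_norm_sub_sq_posterior hπ h0 hσ x x
  have key : ∀ τ : ℝ, 0 < τ →
      ∫ μ, ‖μ - x‖ ^ 2 ∂(posterior σ π x) ≤ d * (σ ^ 2 + τ ^ 2) := fun τ hτ => by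
    set s := √(σ ^ 2 + τ ^ 2) with hs
    have hs0 : 0 < s := by positivity
    have hs2 : s ^ 2 = σ ^ 2 + τ ^ 2 := Real.sq_sqrt (by positivity)
    -- `exp (k ‖μ - x‖² - c)` is the ratio of the normal densities of variances `s²` and `σ²`. Its
    -- posterior mean is a ratio of marginals, at most one by `IsSuperharmonic.marginal_sqrt_le`.
    set k := τ ^ 2 / (2 * σ ^ 2 * s ^ 2)
    have hk : 0 < k := by positivity
    set c : ℝ := d / 2 * Real.log (s ^ 2 / σ ^ 2)
    have hc : c ≤ d / 2 * (τ ^ 2 / σ ^ 2) := by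
      refine mul_le_mul_of_nonneg_left ?_ (by positivity)
      refine (Real.log_le_sub_one_of_pos (by positivity)).trans_eq ?_
      rw [hs2]
      field_simp
      ring
    have hdens : ∀ μ, normalDensity s μ x =
        normalDensity σ μ x * ENNReal.ofReal (Real.exp (k * ‖μ - x‖ ^ 2 - c)) := fun μ => by
      unfold normalDensity
      rw [← ENNReal.ofReal_mul (by positivity), Real.rpow_def_of_pos (by positivity),
        Real.rpow_def_of_pos (by positivity), ← Real.exp_add, ← Real.exp_add, ← Real.exp_add,
        norm_sub_rev x μ]
      congr 2
      simp only [c, k]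
      rw [Real.log_div (by positivity) (by positivity), Real.log_mul (by positivity)
        (by positivity), Real.log_mul (x := 2 * Real.pi) (by positivity) (by positivity)]
      have : τ ^ 2 = s ^ 2 - σ ^ 2 := by linarith
      rw [this]
      field_simp
      ring
    have hm : Measurable fun μ : E d => ENNReal.ofReal (Real.exp (k * ‖μ - x‖ ^ 2 - c)) := by
      fun_prop
    have hlint : ∫⁻ μ, ENNReal.ofReal (Real.exp (k * ‖μ - x‖ ^ 2 - c)) ∂(posterior σ π x) ≤ 1 := by
      rw [lintegral_posterior hπ hm, ← ENNReal.inv_mul_cancel (hπ.marginal_ne_zero h0 hσ x)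
        (hπ.marginal_ne_top hσ x)]
      gcongr
      refine le_trans (le_of_eq ?_) (hπ.marginal_sqrt_le hσ hτ x)
      refine lintegral_congr fun μ => ?_
      rw [← hs, hdens]
      ring
    have hexp : Integrable (fun μ => Real.exp (k * ‖μ - x‖ ^ 2 - c)) (posterior σ π x) :=
      (lintegral_ofReal_ne_top_iff_integrable
        (by fun_prop : Measurable fun μ : E d =>
          Real.exp (k * ‖μ - x‖ ^ 2 - c)).aestronglyMeasurable
        (Filter.Eventually.of_forall fun x => (Real.exp_pos _).le)).1
        (hlint.trans_lt ENNReal.one_lt_top).ne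
    have h1 : ∫ μ, Real.exp (k * ‖μ - x‖ ^ 2 - c) ∂(posterior σ π x) ≤ 1 := by
      rw [integral_eq_lintegral_of_nonneg_ae
        (Filter.Eventually.of_forall fun x => (Real.exp_pos _).le) hexp.aestronglyMeasurable]
      exact ENNReal.toReal_le_of_le_ofReal zero_le_one (by simpa using hlint)
    -- The bound `1 + u ≤ exp u` replaces differentiation in the variance: it gives `k E‖μ - x‖² ≤
    -- c`, while `c ≤ k d s²` by `log u ≤ u - 1`.
    have h2 : ∫ μ, (k * ‖μ - x‖ ^ 2 + (1 - c)) ∂(posterior σ π x) ≤ 1 := by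
      refine le_trans (integral_mono ((hint.const_mul k).add (integrable_const _)) hexp
        fun μ => ?_) h1
      have := Real.add_one_le_exp (k * ‖μ - x‖ ^ 2 - c)
      simp only
      linarith
    rw [integral_add (hint.const_mul k) (integrable_const _), integral_const_mul] at h2
    simp only [integral_const, probReal_univ, one_smul] at h2
    have h3 : k * ∫ μ, ‖μ - x‖ ^ 2 ∂(posterior σ π x) ≤ k * (d * s ^ 2) := by
      refine (by linarith : _ ≤ c).trans (hc.trans_eq ?_)
      simp only [k]
      field_simp
    rw [← hs2]
    exact le_of_mul_le_mul_left h3 hk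
  have hlim : Filter.Tendsto (fun τ : ℝ => d * (σ ^ 2 + τ ^ 2))
      (nhdsWithin 0 (Set.Ioi 0)) (nhds (d * σ ^ 2)) := by
    refine Filter.Tendsto.mono_left ?_ nhdsWithin_le_nhds
    have : Continuous fun τ : ℝ => d * (σ ^ 2 + τ ^ 2) := by fun_prop
    simpa using this.tendsto 0
  exact ge_of_tendsto hlim (Filter.mem_of_superset self_mem_nhdsWithin key)

theorem stronglyMeasurable_integral_posterior {F : Type*} [NormedAddCommGroup F]
    [NormedSpace ℝ F] {f : E d → E d → F} (hf : StronglyMeasurable (Function.uncurry f)) :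
    StronglyMeasurable fun x => ∫ μ, f x μ ∂(posterior σ π x) := by
  let κ : ProbabilityTheory.Kernel (E d) (E d) := ⟨posterior σ π, measurable_posterior hπ.measurable⟩
  have : ProbabilityTheory.IsMarkovKernel κ := ⟨isProbabilityMeasure_posterior hπ h0 hσ⟩
  exact hf.integral_kernel_prod_right (κ := κ)

theorem measurable_posteriorMean : Measurable (posteriorMean σ π) :=
  (stronglyMeasurable_integral_posterior hπ h0 hσ (f := fun _ μ => μ)
    measurable_snd.stronglyMeasurable).measurable

theorem measurable_variance_posterior (i : Fin d) :
    Measurable fun x => ProbabilityTheory.variance (fun μ => μ i) (posterior σ π x) := by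
  have hv : ∀ x, ProbabilityTheory.variance (fun μ => μ i) (posterior σ π x) =
      ∫ μ, (μ i - posteriorMean σ π x i) ^ 2 ∂(posterior σ π x) := fun x => by
    rw [ProbabilityTheory.variance_eq_integral (by fun_prop), posteriorMean_apply hπ h0 hσ]
  simp_rw [hv]
  refine (stronglyMeasurable_integral_posterior hπ h0 hσ (f := fun x μ : E d =>
    (μ i - posteriorMean σ π x i) ^ 2) (Measurable.stronglyMeasurable ?_)).measurable
  have := measurable_posteriorMean hπ h0 hσ
  fun_prop

/-- The bias-variance decomposition of the posterior second moment about a point. -/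
theorem sum_variance_posterior_add (x c : E d) :
    ∑ i, (ProbabilityTheory.variance (fun μ => μ i) (posterior σ π x) +
      (posteriorMean σ π x i - c i) ^ 2) = ∫ μ, ‖μ - c‖ ^ 2 ∂(posterior σ π x) := by
  have := isProbabilityMeasure_posterior hπ h0 hσ x
  have hL : ∀ i, MemLp (fun μ : E d => μ i - c i) 2 (posterior σ π x) := fun i =>
    (memLp_eval_posterior hπ h0 hσ x i).sub (memLp_const _)
  simp_rw [EuclideanSpace.norm_sq_eq, Real.norm_eq_abs, sq_abs, PiLp.sub_apply]
  rw [integral_finsetSum _ fun i _ => (hL i).integrable_sq]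
  refine Finset.sum_congr rfl fun i _ => ?_
  have h1 := ProbabilityTheory.variance_eq_sub (hL i)
  rw [ProbabilityTheory.variance_sub_const (memLp_eval_posterior hπ h0 hσ x i).aestronglyMeasurable,
    integral_sub ((memLp_eval_posterior hπ h0 hσ x i).integrable (by norm_num))
      (integrable_const _)] at h1
  rw [h1, posteriorMean_apply hπ h0 hσ]
  simp

end Posterior

/-! ### Normal moments and Stein's identity -/

section Gaussian

theorem isSuperharmonic_one : IsSuperharmonic (1 : E d → ℝ≥0∞) where
  lowerSemicontinuous := lowerSemicontinuous_const
  exists_ne_top := ⟨0, by simp⟩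
  laverage_ball_le x r hr := by
    have := Metric.measure_ball_pos volume x hr
    simp [setLAverage_eq, ENNReal.div_self this.ne' measure_ball_lt_top.ne]

/-- Viewing the normal law as the posterior of the uniform prior transfers the moment results above
to it. -/
theorem posterior_one (hσ : 0 < σ) (μ : E d) :
    posterior σ 1 μ = law (normalDensity σ μ) := by
  simp [posterior, law, normalDensity_comm _ μ, lintegral_normalDensity hσ]

theorem isProbabilityMeasure_law {q : E d → ℝ≥0∞} (hq : IsDensity q) :
    IsProbabilityMeasure (law q) := by
  constructor
  rw [law, withDensity_apply _ MeasurableSet.univ, setLIntegral_univ, hq.lintegral_eq_one]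

theorem isDensity_normalDensity (hσ : 0 < σ) (μ : E d) : IsDensity (normalDensity σ μ) :=
  ⟨measurable_normalDensity μ, lintegral_normalDensity hσ μ⟩

theorem memLp_id_law_normalDensity (hσ : 0 < σ) (μ : E d) :
    MemLp (fun z : E d => z) 2 (law (normalDensity σ μ)) := by
  rw [← posterior_one hσ]
  exact memLp_id_posterior isSuperharmonic_one ⟨0, by simp⟩ hσ μ

theorem lintegral_law {q f : E d → ℝ≥0∞} (hq : Measurable q) (hf : Measurable f) :
    ∫⁻ z, f z ∂(law q) = ∫⁻ z, f z * q z := by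
  rw [law, lintegral_withDensity_eq_lintegral_mul _ hq hf]
  simp_rw [Pi.mul_apply, mul_comm]

theorem integral_law_normalDensity (μ : E d) (f : E d → ℝ) :
    ∫ z, f z ∂(law (normalDensity σ μ)) = ∫ z, (normalDensity σ μ z).toReal * f z :=
  integral_withDensity_eq_integral_toReal_smul (measurable_normalDensity μ)
    (Filter.Eventually.of_forall fun _ => (normalDensity_ne_top _ _).lt_top) f

theorem integrable_law_normalDensity_iff (μ : E d) (f : E d → ℝ) :
    Integrable f (law (normalDensity σ μ)) ↔
      Integrable fun z => (normalDensity σ μ z).toReal * f z :=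
  integrable_withDensity_iff_integrable_smul' (measurable_normalDensity μ)
    (Filter.Eventually.of_forall fun _ => (normalDensity_ne_top _ _).lt_top)

theorem hasLineDerivAt_normalDensity (hσ : 0 < σ) (μ z : E d) (i : Fin d) :
    HasLineDerivAt ℝ (fun z => (normalDensity σ μ z).toReal)
      (-(z i - μ i) / σ ^ 2 * (normalDensity σ μ z).toReal) z (EuclideanSpace.single i 1) := by
  have hval : ∀ z : E d, (normalDensity σ μ z).toReal =
      (2 * Real.pi * σ ^ 2) ^ (-(d : ℝ) / 2) * Real.exp (-‖z - μ‖ ^ 2 / (2 * σ ^ 2)) :=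
    fun z => ENNReal.toReal_ofReal (by positivity)
  unfold HasLineDerivAt
  simp_rw [hval]
  have hsq : ∀ t : ℝ, ‖z + t • EuclideanSpace.single i (1 : ℝ) - μ‖ ^ 2 =
      ‖z - μ‖ ^ 2 + 2 * (t * (z i - μ i)) + t ^ 2 := fun t => by
    rw [add_sub_right_comm, norm_add_sq_real, real_inner_smul_right, norm_smul,
      EuclideanSpace.inner_single_right]
    simp
  simp_rw [hsq]
  have h1 : HasDerivAt (fun t : ℝ =>
      -(‖z - μ‖ ^ 2 + 2 * (t * (z i - μ i)) + t ^ 2) / (2 * σ ^ 2))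
      (-(z i - μ i) / σ ^ 2) 0 := by
    have := (((((hasDerivAt_id (0 : ℝ)).mul_const (z i - μ i)).const_mul 2).const_add
      (‖z - μ‖ ^ 2)).add (hasDerivAt_pow 2 (0 : ℝ))).neg.div_const (2 * σ ^ 2)
    refine this.congr_deriv ?_
    simp
    field_simp
    ring
  refine (h1.exp.const_mul _).congr_deriv ?_
  simp
  ring

/-- Stein's identity. -/
theorem integral_sub_mul_law_normalDensity (hσ : 0 < σ) (μ : E d) (i : Fin d) {h h' : E d → ℝ}
    (hd : ∀ z, HasLineDerivAt ℝ h (h' z) z (EuclideanSpace.single i 1))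
    (hi : Integrable h (law (normalDensity σ μ))) (hi' : Integrable h' (law (normalDensity σ μ)))
    (hm : Integrable (fun z => (z i - μ i) * h z) (law (normalDensity σ μ))) :
    ∫ z, (z i - μ i) * h z ∂(law (normalDensity σ μ)) =
      σ ^ 2 * ∫ z, h' z ∂(law (normalDensity σ μ)) := by
  rw [integrable_law_normalDensity_iff] at hi hi' hm
  rw [integral_law_normalDensity, integral_law_normalDensity]
  -- Stein's identity is integration by parts: differentiating the normal density produces the
  -- factor `-(z i - μ i) / σ ^ 2`.
  have hm' : Integrable fun z : E d =>
      (-(z i - μ i) / σ ^ 2 * (normalDensity σ μ z).toReal) * h z := by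
    refine (hm.const_mul (-1 / σ ^ 2)).congr (Filter.Eventually.of_forall fun z => ?_)
    simp only
    ring
  have key := integral_bilinear_hasLineDerivAt_right_eq_neg_left_of_integrable (μ := volume)
    (B := ContinuousLinearMap.mul ℝ ℝ) (v := EuclideanSpace.single i (1 : ℝ)) hm' hi' hi
    (fun z _ => hasLineDerivAt_normalDensity hσ μ z i) (fun z _ => hd z)
  simp only [ContinuousLinearMap.mul_apply'] at key
  rw [key, ← integral_neg, ← integral_const_mul]
  refine integral_congr_ae (Filter.Eventually.of_forall fun z => ?_)
  simp only
  field_simp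

theorem memLp_eval_sub_law_normalDensity (hσ : 0 < σ) (μ : E d) (i : Fin d) (c : ℝ) :
    MemLp (fun z : E d => z i - c) 2 (law (normalDensity σ μ)) :=
  have := isProbabilityMeasure_law (isDensity_normalDensity hσ μ)
  ((memLp_id_law_normalDensity hσ μ).eval_piLp i).sub (memLp_const c)

theorem integral_id_law_normalDensity (hσ : 0 < σ) (μ : E d) :
    ∫ z, z ∂(law (normalDensity σ μ)) = μ := by
  have := isProbabilityMeasure_law (isDensity_normalDensity hσ μ)
  have hint : Integrable (fun z : E d => z) (law (normalDensity σ μ)) :=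
    (memLp_id_law_normalDensity hσ μ).integrable (by norm_num)
  ext i
  rw [eval_integral_piLp fun i => hint.eval_piLp i]
  -- Stein's identity for a constant function gives the mean.
  have h := integral_sub_mul_law_normalDensity hσ μ i (h := fun _ => 1) (h' := fun _ => 0)
    (fun z => by simpa [HasLineDerivAt] using hasDerivAt_const (0 : ℝ) (1 : ℝ))
    (integrable_const _) (integrable_const _)
    (by simpa only [mul_one] using! (hint.eval_piLp i).sub (integrable_const (μ i)))
  simp only [mul_one, integral_zero, mul_zero] at h
  rw [integral_sub (hint.eval_piLp i) (integrable_const _)] at h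
  simpa [sub_eq_zero] using h

theorem integral_eval_sub_sq_law_normalDensity (hσ : 0 < σ) (μ : E d) (i : Fin d) :
    ∫ z, (z i - μ i) ^ 2 ∂(law (normalDensity σ μ)) = σ ^ 2 := by
  have := isProbabilityMeasure_law (isDensity_normalDensity hσ μ)
  have hL := memLp_eval_sub_law_normalDensity hσ μ i (μ i)
  -- Stein's identity for the centred coordinate gives the variance.
  have h := integral_sub_mul_law_normalDensity hσ μ i (h := fun z => z i - μ i) (h' := fun _ => 1)
    (fun z => by
      have := (((hasDerivAt_id (0 : ℝ)).const_add (z i)).sub_const (μ i))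
      simpa [HasLineDerivAt] using this)
    (hL.integrable (by norm_num)) (integrable_const _)
    (by simpa only [sq] using hL.integrable_sq)
  simp_rw [sq, h]
  simp [sq]

theorem integral_norm_sub_sq_law_normalDensity (hσ : 0 < σ) (μ : E d) :
    ∫ z, ‖z - μ‖ ^ 2 ∂(law (normalDensity σ μ)) = d * σ ^ 2 := by
  simp_rw [EuclideanSpace.norm_sq_eq, Real.norm_eq_abs, sq_abs, PiLp.sub_apply]
  rw [integral_finsetSum _ fun i _ =>
    (memLp_eval_sub_law_normalDensity hσ μ i (μ i)).integrable_sq]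
  simp [integral_eval_sub_sq_law_normalDensity hσ]

theorem map_add_law_normalDensity (μ v : E d) :
    (law (normalDensity σ μ)).map (fun z => z + v) = law (normalDensity σ (μ + v)) := by
  ext s hs
  have hs' : MeasurableSet ((fun z => z + v) ⁻¹' s) := (measurable_add_const v) hs
  rw [Measure.map_apply (measurable_add_const v) hs, law, law, withDensity_apply _ hs',
    withDensity_apply _ hs, ← lintegral_indicator hs', ← lintegral_indicator hs,
    ← lintegral_add_right_eq_self (s.indicator _) v]
  refine lintegral_congr fun z => ?_
  simp only [Set.indicator, normalDensity, add_sub_add_right_eq_sub]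
  rfl

end Gaussian

/-! ### The Wasserstein loss under translation -/

theorem integral_norm_add_sq {Ω : Type*} [MeasurableSpace Ω] {P : Measure Ω}
    [IsProbabilityMeasure P] {X : Ω → E d} (hX : MemLp X 2 P) (w : E d) :
    ∫ ω, ‖X ω + w‖ ^ 2 ∂P = ∫ ω, ‖X ω‖ ^ 2 ∂P + 2 * inner ℝ (∫ ω, X ω ∂P) w + ‖w‖ ^ 2 := by
  have h1 : Integrable X P := hX.integrable (by norm_num)
  have h2 : Integrable (fun ω => ‖X ω‖ ^ 2) P := hX.integrable_norm_pow (by norm_num)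
  have h3 : Integrable (fun ω => 2 * inner ℝ (X ω) w) P := (h1.inner_const w).const_mul 2
  simp_rw [norm_add_sq_real]
  rw [integral_add (by exact h2.add h3) (integrable_const _), integral_add h2 h3,
    integral_const_mul]
  congr 2
  · simp_rw [real_inner_comm w]
    rw [integral_inner h1]
  · simp

theorem integral_norm_sub_sq {P : Measure (E d)} [IsProbabilityMeasure P]
    (hP : MemLp (fun z : E d => z) 2 P) (c : E d) :
    ∫ z, ‖z - c‖ ^ 2 ∂P = ∫ z, ‖z - ∫ u, u ∂P‖ ^ 2 ∂P + ‖∫ u, u ∂P - c‖ ^ 2 := by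
  have h1 : Integrable (fun z : E d => z) P := hP.integrable (by norm_num)
  have h := integral_norm_add_sq (hP.sub (memLp_const (∫ u, u ∂P))) (∫ u, u ∂P - c)
  simp only [Pi.sub_apply, sub_add_sub_cancel] at h
  rw [h, integral_sub h1 (integrable_const _)]
  simp

theorem lintegral_enorm_sq {Ω : Type*} [MeasurableSpace Ω] {P : Measure Ω} {X : Ω → E d}
    (hX : MemLp X 2 P) : ∫⁻ ω, ‖X ω‖ₑ ^ 2 ∂P = ENNReal.ofReal (∫ ω, ‖X ω‖ ^ 2 ∂P) := by
  rw [ofReal_integral_eq_lintegral_ofReal (hX.integrable_norm_pow (by norm_num))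
    (Filter.Eventually.of_forall fun _ => by positivity)]
  refine lintegral_congr fun ω => ?_
  rw [ENNReal.ofReal_pow (norm_nonneg _), ofReal_norm]

theorem loss_eq_iInf (μ : E d) (q : E d → ℝ≥0∞) :
    loss σ μ q = ⨅ γ ∈ {γ : Measure (E d × E d) |
      γ.map Prod.fst = law (normalDensity σ μ) ∧ γ.map Prod.snd = law q},
        ∫⁻ z, edist z.1 z.2 ^ 2 ∂γ := by
  rw [loss, wassersteinTwo, ← ENNReal.rpow_natCast, ← ENNReal.rpow_mul]
  norm_num

/-- In a coupling of finite cost, `v = u - (u - v)` is a difference of two square-integrable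
variables. -/
theorem memLp_id_law_of_loss_ne_top (hσ : 0 < σ) {μ : E d} {q : E d → ℝ≥0∞}
    (h : loss σ μ q ≠ ∞) : MemLp (fun z : E d => z) 2 (law q) := by
  rw [loss_eq_iInf, ← lt_top_iff_ne_top] at h
  simp only [iInf_lt_iff] at h
  obtain ⟨γ, ⟨h1, h2⟩, hγ⟩ := h
  have hu : MemLp (fun z : E d × E d => z.1) 2 γ := by
    have := memLp_id_law_normalDensity hσ μ
    rw [← h1] at this
    exact this.comp_measurePreserving ⟨measurable_fst, rfl⟩
  have hd : MemLp (fun z : E d × E d => z.1 - z.2) 2 γ := by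
    refine ⟨(by fun_prop : Measurable fun z : E d × E d => z.1 - z.2).aestronglyMeasurable, ?_⟩
    rw [eLpNorm_lt_top_iff_lintegral_rpow_enorm_lt_top (by norm_num) (by norm_num)]
    simpa [edist_eq_enorm_sub] using hγ
  have hv : MemLp (fun z : E d × E d => z.2) 2 γ :=
    (hu.sub hd).ae_eq (Filter.Eventually.of_forall fun z => by simp)
  rw [← h2]
  exact (memLp_map_measure_iff (by fun_prop) (by fun_prop)).2 hv

/-- Shifting the first marginal by `μ - ν` turns a coupling for `ν` into one for `μ`, and its cost
changes by exactly `‖μ - m‖² - ‖ν - m‖²`, with `m` the mean of `q`. Exchanging `μ` and `ν` gives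
equality. -/
theorem loss_add_le (hσ : 0 < σ) {q : E d → ℝ≥0∞} (hq : MemLp (fun z : E d => z) 2 (law q))
    (μ ν : E d) :
    loss σ μ q + ENNReal.ofReal (‖ν - ∫ z, z ∂(law q)‖ ^ 2) ≤
      loss σ ν q + ENNReal.ofReal (‖μ - ∫ z, z ∂(law q)‖ ^ 2) := by
  rw [← tsub_le_iff_right, loss_eq_iInf (σ := σ) ν]
  refine le_iInf₂ fun γ hγ => ?_
  obtain ⟨h1, h2⟩ := hγ
  rw [tsub_le_iff_right]
  have hprob : IsProbabilityMeasure γ := by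
    have := isProbabilityMeasure_law (isDensity_normalDensity hσ ν)
    rw [← h1] at this
    exact Measure.isProbabilityMeasure_of_map Prod.fst
  have hu : MemLp (fun z : E d × E d => z.1) 2 γ := by
    have := memLp_id_law_normalDensity hσ ν
    rw [← h1] at this
    exact this.comp_measurePreserving ⟨measurable_fst, rfl⟩
  have hv : MemLp (fun z : E d × E d => z.2) 2 γ := by
    rw [← h2] at hq
    exact hq.comp_measurePreserving ⟨measurable_snd, rfl⟩
  have hd : MemLp (fun z : E d × E d => z.1 - z.2) 2 γ := hu.sub hv
  have hmu : ∫ z, z.1 ∂γ = ν := by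
    rw [← integral_id_law_normalDensity hσ ν, ← h1,
      integral_map (by fun_prop) (by fun_prop)]
  have hmv : ∫ z, z.2 ∂γ = ∫ z, z ∂(law q) := by
    rw [← h2, integral_map (by fun_prop) (by fun_prop)]
  set w := μ - ν with hw
  set m := ∫ z, z ∂(law q)
  have hmd : ∫ z, z.1 - z.2 ∂γ = ν - m := by
    rw [integral_sub (hu.integrable (by norm_num)) (hv.integrable (by norm_num)), hmu, hmv]
  have hT : Measurable fun z : E d × E d => (z.1 + w, z.2) := by fun_prop
  have hle : loss σ μ q ≤ ∫⁻ z, edist (z.1 + w) z.2 ^ 2 ∂γ := by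
    rw [loss_eq_iInf]
    have hmem : γ.map (fun z => (z.1 + w, z.2)) ∈ {γ : Measure (E d × E d) |
        γ.map Prod.fst = law (normalDensity σ μ) ∧ γ.map Prod.snd = law q} := by
      refine ⟨?_, ?_⟩
      · rw [Measure.map_map measurable_fst hT]
        change γ.map ((fun u => u + w) ∘ Prod.fst) = _
        rw [← Measure.map_map (by fun_prop) measurable_fst, h1, map_add_law_normalDensity, hw,
          add_sub_cancel]
      · rw [Measure.map_map measurable_snd hT, ← h2]
        rfl
    refine (iInf₂_le _ hmem).trans_eq ?_
    rw [lintegral_map (by fun_prop) hT]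
  have e1 : ∫⁻ z, edist (z.1 + w) z.2 ^ 2 ∂γ =
      ENNReal.ofReal (∫ z, ‖z.1 - z.2‖ ^ 2 ∂γ + 2 * inner ℝ (ν - m) w + ‖w‖ ^ 2) := by
    simp_rw [edist_eq_enorm_sub, add_sub_right_comm]
    rw [← hmd, ← integral_norm_add_sq hd]
    exact lintegral_enorm_sq (hd.add (memLp_const w))
  have e2 : ∫⁻ z, edist z.1 z.2 ^ 2 ∂γ = ENNReal.ofReal (∫ z, ‖z.1 - z.2‖ ^ 2 ∂γ) := by
    simp_rw [edist_eq_enorm_sub]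
    exact lintegral_enorm_sq hd
  have h0 : 0 ≤ ∫ z, ‖z.1 - z.2‖ ^ 2 ∂γ + 2 * inner ℝ (ν - m) w + ‖w‖ ^ 2 := by
    rw [← hmd, ← integral_norm_add_sq hd]
    exact integral_nonneg fun _ => by positivity
  refine (add_le_add_left hle _).trans ?_
  rw [e1, e2, ← ENNReal.ofReal_add h0 (by positivity), ← ENNReal.ofReal_add
    (integral_nonneg fun _ => by positivity) (by positivity)]
  refine ENNReal.ofReal_le_ofReal (le_of_eq ?_)
  rw [show μ - m = (ν - m) + w by rw [hw]; abel, norm_add_sq_real]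
  ring

/-- The loss splits into a squared bias and the loss at the mean. -/
theorem loss_eq_add (hσ : 0 < σ) {q : E d → ℝ≥0∞} (hq : MemLp (fun z : E d => z) 2 (law q))
    (μ : E d) :
    loss σ μ q = loss σ (∫ z, z ∂(law q)) q + ENNReal.ofReal (‖μ - ∫ z, z ∂(law q)‖ ^ 2) := by
  have h1 := loss_add_le hσ hq μ (∫ z, z ∂(law q))
  have h2 := loss_add_le hσ hq (∫ z, z ∂(law q)) μ
  simp only [sub_self, norm_zero, ne_eq, OfNat.ofNat_ne_zero, not_false_eq_true, zero_pow,
    ENNReal.ofReal_zero, add_zero] at h1 h2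
  exact le_antisymm h1 h2

theorem ofReal_norm_sub_sq_le_loss (hσ : 0 < σ) (μ : E d) (q : E d → ℝ≥0∞) :
    ENNReal.ofReal (‖μ - ∫ z, z ∂(law q)‖ ^ 2) ≤ loss σ μ q := by
  by_cases h : loss σ μ q = ∞
  · simp [h]
  · rw [loss_eq_add hσ (memLp_id_law_of_loss_ne_top hσ h)]
    exact le_add_self

/-- The coupling by translation, `u ↦ (u, u + (ν - μ))`, has constant cost. -/
theorem loss_normalDensity_le (hσ : 0 < σ) (μ ν : E d) :
    loss σ μ (normalDensity σ ν) ≤ ENNReal.ofReal (‖μ - ν‖ ^ 2) := by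
  have hT : Measurable fun u : E d => (u, u + (ν - μ)) := by fun_prop
  have hmem : (law (normalDensity σ μ)).map (fun u => (u, u + (ν - μ))) ∈
      {γ : Measure (E d × E d) | γ.map Prod.fst = law (normalDensity σ μ) ∧
        γ.map Prod.snd = law (normalDensity σ ν)} := by
    refine ⟨?_, ?_⟩
    · rw [Measure.map_map measurable_fst hT]
      exact Measure.map_id
    · rw [Measure.map_map measurable_snd hT]
      change (law (normalDensity σ μ)).map (fun u => u + (ν - μ)) = _
      rw [map_add_law_normalDensity, add_sub_cancel]
  rw [loss_eq_iInf]
  refine (iInf₂_le _ hmem).trans_eq ?_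
  have := isProbabilityMeasure_law (isDensity_normalDensity hσ μ)
  rw [lintegral_map (by fun_prop) hT]
  simp only [edist_eq_enorm_sub, sub_add_cancel_left, neg_sub]
  simp [← ofReal_norm, ENNReal.ofReal_pow]

/-! ### Minimizers of the posterior expected loss -/

section Bayes

variable {P : Measure (E d)} [IsProbabilityMeasure P] (hP : MemLp (fun z : E d => z) 2 P)
include hP

theorem lintegral_ofReal_norm_sub_sq (c : E d) :
    ∫⁻ μ, ENNReal.ofReal (‖μ - c‖ ^ 2) ∂P =
      ∫⁻ μ, ENNReal.ofReal (‖μ - ∫ u, u ∂P‖ ^ 2) ∂P +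
        ENNReal.ofReal (‖∫ u, u ∂P - c‖ ^ 2) := by
  have h : ∀ c, ∫⁻ μ, ENNReal.ofReal (‖μ - c‖ ^ 2) ∂P =
      ENNReal.ofReal (∫ μ, ‖μ - c‖ ^ 2 ∂P) := fun c =>
    (ofReal_integral_eq_lintegral_ofReal
      ((hP.sub (memLp_const c)).integrable_norm_pow (by norm_num))
      (Filter.Eventually.of_forall fun _ => by positivity)).symm
  rw [h, h, integral_norm_sub_sq hP c, ENNReal.ofReal_add
    (integral_nonneg fun _ => by positivity) (by positivity)]

/-- The loss of any `q` is at least the squared error of its mean, and among points the mean of `P`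
has the least expected squared error. -/
theorem lintegral_loss_normalDensity_le (hσ : 0 < σ) (q : E d → ℝ≥0∞) :
    ∫⁻ μ, loss σ μ (normalDensity σ (∫ u, u ∂P)) ∂P ≤ ∫⁻ μ, loss σ μ q ∂P :=
  calc ∫⁻ μ, loss σ μ (normalDensity σ (∫ u, u ∂P)) ∂P
      ≤ ∫⁻ μ, ENNReal.ofReal (‖μ - ∫ u, u ∂P‖ ^ 2) ∂P :=
        lintegral_mono fun μ => loss_normalDensity_le hσ μ _
    _ ≤ ∫⁻ μ, ENNReal.ofReal (‖μ - ∫ z, z ∂(law q)‖ ^ 2) ∂P := by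
        rw [lintegral_ofReal_norm_sub_sq hP (∫ z, z ∂(law q))]
        exact le_self_add
    _ ≤ ∫⁻ μ, loss σ μ q ∂P := lintegral_mono fun μ => ofReal_norm_sub_sq_le_loss hσ μ q

/-- A minimizer of the expected loss has the loss of the plug-in density. -/
theorem loss_eq_of_lintegral_loss_le (hσ : 0 < σ) {q : E d → ℝ≥0∞}
    (hq : ∫⁻ μ, loss σ μ q ∂P ≤ ∫⁻ μ, loss σ μ (normalDensity σ (∫ u, u ∂P)) ∂P) (μ : E d) :
    loss σ μ q = ENNReal.ofReal (‖μ - ∫ u, u ∂P‖ ^ 2) := by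
  set m₀ := ∫ u, u ∂P
  have hfin : ∫⁻ μ, ENNReal.ofReal (‖μ - m₀‖ ^ 2) ∂P ≠ ∞ :=
    (((hP.sub (memLp_const m₀)).integrable_norm_pow (by norm_num)).lintegral_lt_top).ne
  have hle : ∫⁻ μ, loss σ μ q ∂P ≤ ∫⁻ μ, ENNReal.ofReal (‖μ - m₀‖ ^ 2) ∂P :=
    hq.trans (lintegral_mono fun μ => loss_normalDensity_le hσ μ _)
  -- Without a second moment, `q` would have infinite loss at every `μ`, hence infinite expected
  -- loss.
  have hL : MemLp (fun z : E d => z) 2 (law q) := by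
    by_contra hcon
    have htop : ∀ μ, loss σ μ q = ∞ := fun μ => by
      by_contra h
      exact hcon (memLp_id_law_of_loss_ne_top hσ h)
    simp only [htop, lintegral_const, measure_univ, mul_one, top_le_iff] at hle
    exact hfin hle
  set m := ∫ z, z ∂(law q)
  have hsplit : ∀ μ, loss σ μ q = loss σ m q + ENNReal.ofReal (‖μ - m‖ ^ 2) :=
    loss_eq_add hσ hL
  rw [lintegral_congr hsplit, lintegral_add_left measurable_const, lintegral_const, measure_univ, mul_one,
    lintegral_ofReal_norm_sub_sq hP m, add_left_comm] at hle
  -- The common term is finite and cancels, so both the excess loss and the distance between the two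
  -- means vanish.
  have hzero : loss σ m q + ENNReal.ofReal (‖m₀ - m‖ ^ 2) = 0 := by
    have : ∫⁻ μ, ENNReal.ofReal (‖μ - m₀‖ ^ 2) ∂P +
        (loss σ m q + ENNReal.ofReal (‖m₀ - m‖ ^ 2)) ≤
          ∫⁻ μ, ENNReal.ofReal (‖μ - m₀‖ ^ 2) ∂P + 0 := by simpa using hle
    simpa using (ENNReal.add_le_add_iff_left hfin).1 this
  rw [add_eq_zero, ENNReal.ofReal_eq_zero] at hzero
  have hm : m₀ = m := by
    have := le_antisymm hzero.2 (by positivity)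
    simpa [sub_eq_zero] using this
  rw [hsplit, hzero.1, zero_add, hm]

end Bayes

/-! ### Upper bound: quadratic risk of the posterior mean -/

section UpperBound

variable (hπ : IsSuperharmonic π) (h0 : ∃ μ, π μ ≠ 0) (hσ : 0 < σ)
include hπ h0 hσ

theorem sum_variance_add_sq_le (x : E d) :
    ∑ i, (ProbabilityTheory.variance (fun μ => μ i) (posterior σ π x) +
      (posteriorMean σ π x i - x i) ^ 2) ≤ d * σ ^ 2 :=
  (sum_variance_posterior_add hπ h0 hσ x x).trans_le
    (integral_norm_sub_sq_posterior_le hπ h0 hσ x)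

theorem variance_add_sq_le (x : E d) (i : Fin d) :
    ProbabilityTheory.variance (fun μ => μ i) (posterior σ π x) +
      (posteriorMean σ π x i - x i) ^ 2 ≤ d * σ ^ 2 :=
  (Finset.single_le_sum (f := fun i => ProbabilityTheory.variance (fun μ => μ i)
    (posterior σ π x) + (posteriorMean σ π x i - x i) ^ 2)
    (fun _ _ => add_nonneg (ProbabilityTheory.variance_nonneg _ _) (sq_nonneg _))
    (Finset.mem_univ i)).trans (sum_variance_add_sq_le hπ h0 hσ x)

theorem memLp_posteriorMean_sub (θ : E d) (i : Fin d) :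
    MemLp (fun x => posteriorMean σ π x i - x i) 2 (law (normalDensity σ θ)) := by
  have := isProbabilityMeasure_law (isDensity_normalDensity hσ θ)
  have hm := measurable_posteriorMean hπ h0 hσ
  refine MemLp.of_bound (by fun_prop) √(d * σ ^ 2) (Filter.Eventually.of_forall fun x => ?_)
  refine Real.abs_le_sqrt (le_trans ?_ (variance_add_sq_le hπ h0 hσ x i))
  exact le_add_of_nonneg_left (ProbabilityTheory.variance_nonneg _ _)

theorem integrable_variance_posterior (θ : E d) (i : Fin d) :
    Integrable (fun x => ProbabilityTheory.variance (fun μ => μ i) (posterior σ π x))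
      (law (normalDensity σ θ)) := by
  have := isProbabilityMeasure_law (isDensity_normalDensity hσ θ)
  refine Integrable.of_bound
    (measurable_variance_posterior hπ h0 hσ i).aestronglyMeasurable (d * σ ^ 2)
    (Filter.Eventually.of_forall fun x => ?_)
  rw [Real.norm_of_nonneg (ProbabilityTheory.variance_nonneg _ _)]
  exact le_trans (le_add_of_nonneg_right (sq_nonneg _)) (variance_add_sq_le hπ h0 hσ x i)

theorem hasLineDerivAt_posteriorMean_sub (x : E d) (i : Fin d) :
    HasLineDerivAt ℝ (fun x => posteriorMean σ π x i - x i)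
      (ProbabilityTheory.variance (fun μ => μ i) (posterior σ π x) / σ ^ 2 - 1) x
      (EuclideanSpace.single i 1) := by
  have h1 : HasDerivAt (fun t : ℝ => (x + t • EuclideanSpace.single i (1 : ℝ)) i) 1 0 := by
    simpa using (hasDerivAt_id (0 : ℝ)).const_add (x i)
  have h2 := hasLineDerivAt_posteriorMean hπ h0 hσ x i
  unfold HasLineDerivAt at h2 ⊢
  exact h2.fun_sub h1

/-- Stein's unbiased estimate of the risk, coordinate by coordinate. -/
theorem integral_posteriorMean_sub_sq (θ : E d) (i : Fin d) :
    ∫ x, (posteriorMean σ π x i - θ i) ^ 2 ∂(law (normalDensity σ θ)) =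
      ∫ x, (2 * ProbabilityTheory.variance (fun μ => μ i) (posterior σ π x) +
        (posteriorMean σ π x i - x i) ^ 2) ∂(law (normalDensity σ θ)) - σ ^ 2 := by
  have := isProbabilityMeasure_law (isDensity_normalDensity hσ θ)
  have hh := memLp_posteriorMean_sub hπ h0 hσ θ i
  have hv := integrable_variance_posterior hπ h0 hσ θ i
  have hx := memLp_eval_sub_law_normalDensity hσ θ i (θ i)
  have hcross : Integrable (fun x : E d => (x i - θ i) * (posteriorMean σ π x i - x i))
      (law (normalDensity σ θ)) := hx.integrable_mul hh
  have hstein := integral_sub_mul_law_normalDensity hσ θ i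
    (h := fun x => posteriorMean σ π x i - x i)
    (h' := fun x => ProbabilityTheory.variance (fun μ => μ i) (posterior σ π x) / σ ^ 2 - 1)
    (fun z => hasLineDerivAt_posteriorMean_sub hπ h0 hσ z i)
    (hh.integrable (by norm_num)) ((hv.div_const _).sub (integrable_const _)) hcross
  rw [integral_sub (hv.div_const _) (integrable_const _), integral_div] at hstein
  simp only [integral_const, probReal_univ, one_smul] at hstein
  -- The estimation error is split at the observation `x`; Stein's identity evaluates the cross
  -- term.
  have hexpand : ∀ x, (posteriorMean σ π x i - θ i) ^ 2 = (x i - θ i) ^ 2 +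
      2 * ((x i - θ i) * (posteriorMean σ π x i - x i)) +
        (posteriorMean σ π x i - x i) ^ 2 := fun x => by ring
  simp_rw [hexpand]
  rw [integral_add (by exact hx.integrable_sq.add (hcross.const_mul 2)) hh.integrable_sq,
    integral_add hx.integrable_sq (hcross.const_mul 2), integral_const_mul, hstein,
    integral_eval_sub_sq_law_normalDensity hσ, integral_add (hv.const_mul 2) hh.integrable_sq,
    integral_const_mul]
  field_simp
  ring

theorem integral_norm_posteriorMean_sub_sq_le (θ : E d) :
    Integrable (fun x => ‖θ - posteriorMean σ π x‖ ^ 2) (law (normalDensity σ θ)) ∧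
      ∫ x, ‖θ - posteriorMean σ π x‖ ^ 2 ∂(law (normalDensity σ θ)) ≤ d * σ ^ 2 := by
  have := isProbabilityMeasure_law (isDensity_normalDensity hσ θ)
  have hsq : ∀ x, ‖θ - posteriorMean σ π x‖ ^ 2 = ∑ i, (posteriorMean σ π x i - θ i) ^ 2 :=
    fun x => by
      rw [norm_sub_rev]
      simp [EuclideanSpace.norm_sq_eq]
  have hL : ∀ i, Integrable (fun x => (posteriorMean σ π x i - θ i) ^ 2)
      (law (normalDensity σ θ)) := fun i =>
    (((memLp_posteriorMean_sub hπ h0 hσ θ i).add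
      (memLp_eval_sub_law_normalDensity hσ θ i (θ i))).ae_eq
        (Filter.Eventually.of_forall fun x => by simp)).integrable_sq
  simp_rw [hsq]
  refine ⟨integrable_finsetSum _ fun i _ => hL i, ?_⟩
  have hR : ∀ i, Integrable (fun x =>
      2 * ProbabilityTheory.variance (fun μ => μ i) (posterior σ π x) +
        (posteriorMean σ π x i - x i) ^ 2) (law (normalDensity σ θ)) := fun i =>
    ((integrable_variance_posterior hπ h0 hσ θ i).const_mul 2).add
      (memLp_posteriorMean_sub hπ h0 hσ θ i).integrable_sq
  rw [integral_finsetSum _ fun i _ => hL i]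
  simp_rw [integral_posteriorMean_sub_sq hπ h0 hσ]
  rw [Finset.sum_sub_distrib, ← integral_finsetSum _ fun i _ => hR i]
  have hle : ∫ x, ∑ i, (2 * ProbabilityTheory.variance (fun μ => μ i) (posterior σ π x) +
      (posteriorMean σ π x i - x i) ^ 2) ∂(law (normalDensity σ θ)) ≤
        ∫ _, 2 * (d * σ ^ 2) ∂(law (normalDensity σ θ)) := by
    refine integral_mono (integrable_finsetSum _ fun i _ => hR i) (integrable_const _) fun x => ?_
    refine le_trans ?_ (mul_le_mul_of_nonneg_left (sum_variance_add_sq_le hπ h0 hσ x) zero_le_two)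
    rw [Finset.mul_sum]
    refine Finset.sum_le_sum fun i _ => ?_
    -- The slack in `2 Var_i + b_i² ≤ 2 (Var_i + b_i²)` is `b_i²`.
    nlinarith [sq_nonneg (posteriorMean σ π x i - x i)]
  simp only [integral_const, probReal_univ, one_smul] at hle
  simp only [Finset.sum_const, Finset.card_univ, Fintype.card_fin, nsmul_eq_mul]
  linarith

/-- The quadratic risk of the posterior mean. -/
theorem lintegral_norm_posteriorMean_sub_sq_le (θ : E d) :
    ∫⁻ x, ENNReal.ofReal (‖θ - posteriorMean σ π x‖ ^ 2) * normalDensity σ θ x ≤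
      ENNReal.ofReal (d * σ ^ 2) := by
  have hm := measurable_posteriorMean hπ h0 hσ
  obtain ⟨hi, hle⟩ := integral_norm_posteriorMean_sub_sq_le hπ h0 hσ θ
  rw [← lintegral_law (measurable_normalDensity θ) (by fun_prop),
    ← ofReal_integral_eq_lintegral_ofReal hi (Filter.Eventually.of_forall fun _ => by positivity)]
  exact ENNReal.ofReal_le_ofReal hle

end UpperBound

theorem isPredictiveDensity_plugIn (hσ : 0 < σ) {m : E d → E d} (hm : Measurable m) :
    IsPredictiveDensity (plugIn σ m) where
  measurable := by
    have h : Function.uncurry (plugIn σ m) =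
        Function.uncurry (normalDensity σ) ∘ fun z : E d × E d => (m z.1, z.2) := rfl
    rw [h]
    exact measurable_uncurry_normalDensity.comp ((hm.comp measurable_fst).prodMk measurable_snd)
  lintegral_eq_one x := lintegral_normalDensity hσ (m x)

/-! ### Lower bound: Bayes risks of normal priors -/

section LowerBound

theorem IsPredictiveDensity.isDensity {p : E d → E d → ℝ≥0∞} (hp : IsPredictiveDensity p)
    (x : E d) : IsDensity (p x) :=
  ⟨hp.measurable.of_uncurry_left, hp.lintegral_eq_one x⟩

theorem IsPredictiveDensity.measurable_mean {p : E d → E d → ℝ≥0∞} (hp : IsPredictiveDensity p) :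
    Measurable fun x => ∫ z, z ∂(law (p x)) := by
  have h : ∀ x, ∫ z, z ∂(law (p x)) = ∫ z, (p x z).toReal • z := fun x =>
    integral_withDensity_eq_integral_toReal_smul (hp.isDensity x).measurable
      (ae_lt_top (hp.isDensity x).measurable (by simp [hp.lintegral_eq_one x])) _
  simp_rw [h]
  have hm : Measurable (Function.uncurry fun x z : E d => (p x z).toReal • z) :=
    hp.measurable.ennreal_toReal.smul measurable_snd
  exact hm.stronglyMeasurable.integral_prod_right.measurable

/-- Used with the normal posterior of a normal prior: no point estimate beats its total variance. -/
theorem ofReal_le_lintegral_norm_sub_sq {ρ : ℝ} (hρ : 0 < ρ) (b c : E d) :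
    ENNReal.ofReal (d * ρ ^ 2) ≤
      ∫⁻ μ, ENNReal.ofReal (‖μ - c‖ ^ 2) * normalDensity ρ b μ := by
  have := isProbabilityMeasure_law (isDensity_normalDensity hρ b)
  have hL := memLp_id_law_normalDensity hρ b
  rw [← lintegral_law (measurable_normalDensity b) (by fun_prop),
    lintegral_ofReal_norm_sub_sq hL c, integral_id_law_normalDensity hρ,
    ← ofReal_integral_eq_lintegral_ofReal (f := fun μ => ‖μ - b‖ ^ 2)
      ((hL.sub (memLp_const b)).integrable_norm_pow (by norm_num))
      (Filter.Eventually.of_forall fun _ => by positivity), integral_norm_sub_sq_law_normalDensity hρ]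
  exact le_self_add

/-- The maximum risk is at least the Bayes risk of every normal prior. -/
theorem ofReal_bayesRisk_le_iSup_risk (hσ : 0 < σ) (hτ : 0 < τ) {p : E d → E d → ℝ≥0∞}
    (hp : IsPredictiveDensity p) :
    ENNReal.ofReal (d * (σ * τ / √(σ ^ 2 + τ ^ 2)) ^ 2) ≤ ⨆ μ, risk σ μ p := by
  set s := √(σ ^ 2 + τ ^ 2)
  have hs0 : 0 < s := by positivity
  have hs2 : s ^ 2 = σ ^ 2 + τ ^ 2 := Real.sq_sqrt (by positivity)
  set ρ := σ * τ / s
  have hρ : 0 < ρ := by positivity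
  set δ : E d → E d := fun x => ∫ z, z ∂(law (p x))
  have hδ : Measurable δ := hp.measurable_mean
  have hrisk : ∀ μ, ∫⁻ x, ENNReal.ofReal (‖μ - δ x‖ ^ 2) * normalDensity σ μ x ≤ risk σ μ p :=
    fun μ => lintegral_mono fun x => by
      gcongr
      exact ofReal_norm_sub_sq_le_loss hσ μ (p x)
  have hm : Measurable (Function.uncurry fun x μ : E d =>
      ENNReal.ofReal (‖μ - δ x‖ ^ 2) * normalDensity σ μ x * normalDensity τ 0 μ) := by
    refine (Measurable.mul ?_ (measurable_uncurry_normalDensity.comp measurable_swap)).mul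
      ((measurable_normalDensity 0).comp measurable_snd)
    fun_prop
  calc ENNReal.ofReal (d * ρ ^ 2)
      = ∫⁻ x, normalDensity s 0 x * ENNReal.ofReal (d * ρ ^ 2) := by
        rw [lintegral_mul_const _ (measurable_normalDensity (0 : E d)),
          lintegral_normalDensity hs0, one_mul]
    _ ≤ ∫⁻ x, ∫⁻ μ, ENNReal.ofReal (‖μ - δ x‖ ^ 2) * normalDensity σ μ x *
          normalDensity τ 0 μ := by
        -- Completing the square factors the joint density into the marginal of `x` and the
        -- posterior of `μ`, whose variance `ρ²` does not depend on `x`.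
        refine lintegral_mono fun x => ?_
        refine (mul_le_mul_right (ofReal_le_lintegral_norm_sub_sq hρ
          (0 + (τ ^ 2 / s ^ 2) • (x - 0)) (δ x)) _).trans_eq ?_
        rw [← lintegral_const_mul' _ _ (normalDensity_ne_top _ _)]
        refine lintegral_congr fun μ => ?_
        rw [mul_assoc (ENNReal.ofReal _), normalDensity_mul_normalDensity hσ hτ hs0 hρ hs2
          (div_mul_cancel₀ _ hs0.ne') x 0 μ]
        ring
    _ = ∫⁻ μ, ∫⁻ x, ENNReal.ofReal (‖μ - δ x‖ ^ 2) * normalDensity σ μ x *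
          normalDensity τ 0 μ := lintegral_lintegral_swap hm.aemeasurable
    _ ≤ ∫⁻ μ, (⨆ μ, risk σ μ p) * normalDensity τ 0 μ := by
        refine lintegral_mono fun μ => ?_
        rw [lintegral_mul_const' _ _ (normalDensity_ne_top _ _)]
        gcongr
        exact (hrisk μ).trans (le_iSup (fun μ => risk σ μ p) μ)
    _ = ⨆ μ, risk σ μ p := by
        rw [lintegral_const_mul _ (measurable_normalDensity (0 : E d)),
          lintegral_normalDensity hτ, mul_one]

theorem ofReal_le_iSup_risk (hσ : 0 < σ) {p : E d → E d → ℝ≥0∞} (hp : IsPredictiveDensity p) :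
    ENNReal.ofReal (d * σ ^ 2) ≤ ⨆ μ, risk σ μ p := by
  -- With `ε = 1 / τ` the Bayes risk `d σ² τ² / (σ² + τ²)` becomes continuous at `ε = 0`, where it
  -- equals `d σ²`.
  have hlim : Filter.Tendsto (fun ε : ℝ => ENNReal.ofReal (d * (σ ^ 2 / (1 + σ ^ 2 * ε ^ 2))))
      (nhdsWithin 0 (Set.Ioi 0)) (nhds (ENNReal.ofReal (d * σ ^ 2))) := by
    refine (ENNReal.tendsto_ofReal ?_).mono_left nhdsWithin_le_nhds
    have : Continuous fun ε : ℝ => d * (σ ^ 2 / (1 + σ ^ 2 * ε ^ 2)) := by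
      fun_prop (disch := intro; positivity)
    simpa using this.tendsto 0
  refine le_of_tendsto hlim (Filter.mem_of_superset self_mem_nhdsWithin fun ε hε => ?_)
  have hε' : 0 < ε := hε
  refine le_trans (le_of_eq ?_) (ofReal_bayesRisk_le_iSup_risk hσ (inv_pos.2 hε') hp)
  congr 2
  rw [div_pow, Real.sq_sqrt (by positivity)]
  field_simp
  ring

end LowerBound

end PredictiveDensity

theorem mainTheorem10 (d : ℕ) (hd : 1 ≤ d) (σ : ℝ) (hσ : 0 < σ) (π : PredictiveDensity.E d → ℝ≥0∞)
    (hπ : PredictiveDensity.IsSuperharmonic π) (hπ0 : ∃ μ, π μ ≠ 0) :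
    (∀ x, IsProbabilityMeasure (PredictiveDensity.posterior σ π x) ∧
      Integrable (fun μ => μ) (PredictiveDensity.posterior σ π x)) ∧
    PredictiveDensity.IsBayes σ π
      (PredictiveDensity.plugIn σ (PredictiveDensity.posteriorMean σ π)) ∧
    ∀ p : PredictiveDensity.E d → PredictiveDensity.E d → ℝ≥0∞,
      PredictiveDensity.IsBayes σ π p → PredictiveDensity.IsMinimax σ p := by
  have hprob := PredictiveDensity.isProbabilityMeasure_posterior hπ hπ0 hσ
  have hL := PredictiveDensity.memLp_id_posterior hπ hπ0 hσ
  have hmean := PredictiveDensity.measurable_posteriorMean hπ hπ0 hσ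
  refine ⟨fun x => ⟨hprob x, PredictiveDensity.integrable_id_posterior hπ hπ0 hσ x⟩,
    ⟨PredictiveDensity.isPredictiveDensity_plugIn hσ hmean,
      Filter.Eventually.of_forall fun x q _ =>
        PredictiveDensity.lintegral_loss_normalDensity_le (hL x) hσ q⟩,
    fun p hp => ⟨hp.1, fun q hq => ?_⟩⟩
  refine (iSup_le fun θ => ?_).trans (PredictiveDensity.ofReal_le_iSup_risk hσ hq)
  refine le_trans (le_of_eq ?_)
    (PredictiveDensity.lintegral_norm_posteriorMean_sub_sq_le hπ hπ0 hσ θ)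
  refine lintegral_congr_ae ?_
  -- Comparing with the plug-in density as competitor fixes the loss of `p x` for almost every `x`,
  -- which suffices for the risk at every `θ`.
  filter_upwards [hp.2] with x hx
  rw [PredictiveDensity.loss_eq_of_lintegral_loss_le (hL x) hσ
    (hx _ (PredictiveDensity.isDensity_normalDensity hσ _)) θ]
  rfl
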